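/- Let $\mathfrak{g}$ be a non-abelian six-dimensional nilpotent real Lie algebra. A *Born structure* on $\mathfrak{g}$ is a triple $(g,h,\omega)$, where $g,h$ are non-degenerate symmetric bilinear forms on $\mathfrak g$ (of arbitrary signature) and $\omega$ is a non-degenerate alternating bilinear form on $\mathfrak g$, such that the endomorphisms $A,B,J$ determined by $g(AX,Y)=\omega(X,Y)$, $g(BX,Y)=h(X,Y)$ and $\omega(-JX,Y)=h(X,Y)$ satisfy $A^2=B^2=-J^2=\mathrm{Id}$. It is *integrable* if $\omega$ is closed under the Chevalley–Eilenberg differential, the Nijenhuis tensor of $J$ vanishes, and the $\pm1$-eigenspaces $\mathfrak{g}_\pm$ of $A$ are Lie subalgebras of $\mathfrak{g}$. Let $\mathfrak h_8=(0,0,0,0,0,12)$ be the real Lie algebra with a basis $e_1,\dots,e_6$ whose dual basis satisfies $de^1=\dots=de^5=0$ and $de^6=e^1\wedge e^2$, and let $\mathfrak h_9=(0,0,0,0,12,14+25)$ be the one with a basis whose dual basis satisfies $de^1=\dots=de^4=0$, $de^5=e^1\wedge e^2$ and $de^6=e^1\wedge e^4+e^2\wedge e^5$, where $d\alpha(X,Y)=-\alpha([X,Y])$.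 Then $\mathfrak{g}$ admits an integrable Born structure for which both subalgebras $\mathfrak{g}_+$ and $\mathfrak{g}_-$ are abelian if and only if $\mathfrak{g}\cong\mathfrak{h}_8$ or $\mathfrak{g}\cong\mathfrak{h}_9$. -/

import Mathlib

namespace BornLie

section Born

variable (𝔤 : Type*) [LieRing 𝔤] [LieAlgebra ℝ 𝔤]

/-- `A` is the recursion operator from the bilinear form `a` to the bilinear form `b`:
`a (A X, Y) = b (X, Y)` for all `X`, `Y`. On a finite-dimensional space and for non-degenerate
`a`, `b` there is exactly one such `A`, and it is invertible. -/
def IsRecursionOperator {𝔤 : Type*} [LieRing 𝔤] [LieAlgebra ℝ 𝔤]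
    (a b : LinearMap.BilinForm ℝ 𝔤) (A : Module.End ℝ 𝔤) : Prop :=
  ∀ X Y : 𝔤, a (A X) Y = b X Y

/-- A Born structure on a real Lie algebra: pseudo-Riemannian metrics `g`, `h` (of any signature)
and a non-degenerate two-form `ω` such that the recursion operators `A : g → ω`, `B : g → h`,
`-J : ω → h` satisfy `A² = B² = -J² = Id`. -/
structure BornStructure where
  g : LinearMap.BilinForm ℝ 𝔤
  h : LinearMap.BilinForm ℝ 𝔤
  ω : LinearMap.BilinForm ℝ 𝔤
  g_symm : g.IsSymm
  g_nondegenerate : g.Nondegenerate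
  h_symm : h.IsSymm
  h_nondegenerate : h.Nondegenerate
  ω_alt : ω.IsAlt
  ω_nondegenerate : ω.Nondegenerate
  A : Module.End ℝ 𝔤
  B : Module.End ℝ 𝔤
  J : Module.End ℝ 𝔤
  recursion_A : IsRecursionOperator g ω A
  recursion_B : IsRecursionOperator g h B
  recursion_J : IsRecursionOperator ω h (-J)
  A_sq : A * A = 1
  B_sq : B * B = 1
  J_sq : J * J = -1

variable {𝔤}

/-- The Chevalley–Eilenberg differential of a two-form (trivial coefficients). -/
def ceDifferential (ω : LinearMap.BilinForm ℝ 𝔤) (X Y Z : 𝔤) : ℝ :=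
  -ω ⁅X, Y⁆ Z + ω ⁅X, Z⁆ Y - ω ⁅Y, Z⁆ X

/-- The Nijenhuis tensor of an almost complex structure. -/
def nijenhuis (J : Module.End ℝ 𝔤) (X Y : 𝔤) : 𝔤 :=
  ⁅J X, J Y⁆ - J ⁅J X, Y⁆ - J ⁅X, J Y⁆ - ⁅X, Y⁆

/-- A Born structure is integrable if `ω` is closed, `J` has vanishing Nijenhuis tensor and the
`±1`-eigenspaces of `A` are closed under the Lie bracket. -/
structure BornStructure.IsIntegrable (S : BornStructure 𝔤) : Prop where
  closed : ∀ X Y Z : 𝔤, ceDifferential S.ω X Y Z = 0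
  nijenhuis_eq_zero : ∀ X Y : 𝔤, nijenhuis S.J X Y = 0
  plus_lie_mem : ∀ X ∈ S.A.eigenspace 1, ∀ Y ∈ S.A.eigenspace 1, ⁅X, Y⁆ ∈ S.A.eigenspace 1
  minus_lie_mem :
    ∀ X ∈ S.A.eigenspace (-1), ∀ Y ∈ S.A.eigenspace (-1), ⁅X, Y⁆ ∈ S.A.eigenspace (-1)

/-- The subalgebra `𝔤₊`: the `+1`-eigenspace of `A`. -/
def BornStructure.IsIntegrable.gPlus {S : BornStructure 𝔤} (hS : S.IsIntegrable) :
    LieSubalgebra ℝ 𝔤 :=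
  { S.A.eigenspace 1 with lie_mem' := fun {X Y} hX hY => hS.plus_lie_mem X hX Y hY }

/-- The subalgebra `𝔤₋`: the `-1`-eigenspace of `A`. -/
def BornStructure.IsIntegrable.gMinus {S : BornStructure 𝔤} (hS : S.IsIntegrable) :
    LieSubalgebra ℝ 𝔤 :=
  { S.A.eigenspace (-1) with lie_mem' := fun {X Y} hX hY => hS.minus_lie_mem X hX Y hY }

end Born

/-- `e^{ij} = e^i ∧ e^j` evaluated at `x`, `y`, where `e^1, …, e^6` is the dual of the standard
basis `e_1, …, e_6` of `ℝ⁶` (the index `k : Fin 6` stands for `e_{k+1}`). -/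
def wedge (i j : Fin 6) (x y : Fin 6 → ℝ) : ℝ := x i * y j - x j * y i

/-- The underlying space `ℝ⁶` of the Lie algebra `𝔥₈ = (0,0,0,0,0,12)`. -/
def H8 : Type := Fin 6 → ℝ

/-- The underlying space `ℝ⁶` of the Lie algebra `𝔥₉ = (0,0,0,0,12,14+25)`. -/
def H9 : Type := Fin 6 → ℝ

instance : AddCommGroup H8 := inferInstanceAs (AddCommGroup (Fin 6 → ℝ))
instance : Module ℝ H8 := inferInstanceAs (Module ℝ (Fin 6 → ℝ))
instance : AddCommGroup H9 := inferInstanceAs (AddCommGroup (Fin 6 → ℝ))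
instance : Module ℝ H9 := inferInstanceAs (Module ℝ (Fin 6 → ℝ))

/-- `de^6 = e^{12}` and the other `de^k` vanish, where `dα (x, y) = -α [x, y]`. -/
def H8.bracket (x y : Fin 6 → ℝ) : Fin 6 → ℝ := ![0, 0, 0, 0, 0, -wedge 0 1 x y]

/-- `de^5 = e^{12}`, `de^6 = e^{14} + e^{25}` and the other `de^k` vanish, where
`dα (x, y) = -α [x, y]`. -/
def H9.bracket (x y : Fin 6 → ℝ) : Fin 6 → ℝ :=
  ![0, 0, 0, 0, -wedge 0 1 x y, -(wedge 0 3 x y + wedge 1 4 x y)]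

instance : LieRing H8 where
  bracket := H8.bracket
  add_lie (x y z : Fin 6 → ℝ) := by
    change H8.bracket (x + y) z = H8.bracket x z + H8.bracket y z
    ext k; fin_cases k <;> simp [H8.bracket, wedge] <;> ring
  lie_add (x y z : Fin 6 → ℝ) := by
    change H8.bracket x (y + z) = H8.bracket x y + H8.bracket x z
    ext k; fin_cases k <;> simp [H8.bracket, wedge] <;> ring
  lie_self (x : Fin 6 → ℝ) := by
    change H8.bracket x x = 0
    ext k; fin_cases k <;> simp [H8.bracket, wedge] <;> ring
  leibniz_lie (x y z : Fin 6 → ℝ) := by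
    change H8.bracket x (H8.bracket y z) =
      H8.bracket (H8.bracket x y) z + H8.bracket y (H8.bracket x z)
    ext k; fin_cases k <;> simp [H8.bracket, wedge]

instance : LieAlgebra ℝ H8 where
  lie_smul (t : ℝ) (x y : Fin 6 → ℝ) := by
    change H8.bracket x (t • y) = t • H8.bracket x y
    ext k; fin_cases k <;> simp [H8.bracket, wedge] <;> ring

instance : LieRing H9 where
  bracket := H9.bracket
  add_lie (x y z : Fin 6 → ℝ) := by
    change H9.bracket (x + y) z = H9.bracket x z + H9.bracket y z
    ext k; fin_cases k <;> simp [H9.bracket, wedge] <;> ring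
  lie_add (x y z : Fin 6 → ℝ) := by
    change H9.bracket x (y + z) = H9.bracket x y + H9.bracket x z
    ext k; fin_cases k <;> simp [H9.bracket, wedge] <;> ring
  lie_self (x : Fin 6 → ℝ) := by
    change H9.bracket x x = 0
    ext k; fin_cases k <;> simp [H9.bracket, wedge] <;> ring
  leibniz_lie (x y z : Fin 6 → ℝ) := by
    change H9.bracket x (H9.bracket y z) =
      H9.bracket (H9.bracket x y) z + H9.bracket y (H9.bracket x z)
    ext k; fin_cases k <;> simp [H9.bracket, wedge] <;> ring

instance : LieAlgebra ℝ H9 where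
  lie_smul (t : ℝ) (x y : Fin 6 → ℝ) := by
    change H9.bracket x (t • y) = t • H9.bracket x y
    ext k; fin_cases k <;> simp [H9.bracket, wedge] <;> ring

end BornLie

/-! The compatibility relations make `A` and `J` anticommute, so `J` maps 𝔤₊ onto 𝔤₋ and 𝔤 = V ⊕ JV
with V = 𝔤₊ of dimension three. When both summands are abelian, the whole bracket is [X, JY] =
p(X,Y) + J q(X,Y). Integrability of `J` says that p and q are commutative, closedness of ω says that
both are invariant for b(X,Y) = ω(JX,Y), the Jacobi identity gives the exchange laws such as p(X,
q(Y,Z)) = p(Y, q(X,Z)), and nilpotency together with dim V = 3 makes cubes of translations vanish.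
This is a `FrobeniusPair`.

Such pairs are classified by cubes. If some x has x³ = p(x, p(x,x)) ≠ 0, then x, x², x³ is a basis,
q is upper triangular in it, and an adapted basis gives `H9`; a nonzero cube for q reduces to this
by exchanging the summands. If all cubes vanish, polarization and `pq_eq_zero` kill every triple
product. By invariance the products then span an isotropic subspace, hence at most a line ℝv, and p,
q are multiples of b(v,·)b(v,·)v (`exists_rank_one`), which gives `H8` when 𝔤 is not abelian.

Conversely, one constant triple on ℝ⁶ is integrable for both brackets. -/

namespace BornLie

/-! ### A Born structure on ℝ⁶ serving both algebras -/

section Model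

/-- The two-form `-e^{13} - e^{26} - e^{45}` on `ℝ⁶`. -/
def modelForm : LinearMap.BilinForm ℝ (Fin 6 → ℝ) :=
  LinearMap.mk₂ ℝ (fun x y => -wedge 0 2 x y - wedge 1 5 x y - wedge 3 4 x y)
    (fun x y z => by simp [wedge]; ring) (fun c x y => by simp [wedge]; ring)
    (fun x y z => by simp [wedge]; ring) (fun c x y => by simp [wedge]; ring)

theorem modelForm_apply (x y : Fin 6 → ℝ) :
    modelForm x y = -wedge 0 2 x y - wedge 1 5 x y - wedge 3 4 x y := rfl

/-- The para-complex structure with `e_1, e_5, e_6` of eigenvalue `1` and `e_2, e_3, e_4` of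
eigenvalue `-1`. -/
def modelPara : Module.End ℝ (Fin 6 → ℝ) where
  toFun x := ![x 0, -x 1, -x 2, -x 3, x 4, x 5]
  map_add' x y := by ext k; fin_cases k <;> simp <;> ring
  map_smul' c x := by ext k; fin_cases k <;> simp

/-- The complex structure with `e_1 ↦ e_2`, `e_3 ↦ e_6`, `e_4 ↦ e_5`. -/
def modelComplex : Module.End ℝ (Fin 6 → ℝ) where
  toFun x := ![-x 1, x 0, -x 5, -x 4, x 3, x 2]
  map_add' x y := by ext k; fin_cases k <;> simp <;> ring
  map_smul' c x := by ext k; fin_cases k <;> simp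

theorem modelPara_apply (x : Fin 6 → ℝ) :
    modelPara x = ![x 0, -x 1, -x 2, -x 3, x 4, x 5] := rfl

theorem modelComplex_apply (x : Fin 6 → ℝ) :
    modelComplex x = ![-x 1, x 0, -x 5, -x 4, x 3, x 2] := rfl

theorem modelPara_modelPara (x : Fin 6 → ℝ) : modelPara (modelPara x) = x := by
  ext k; fin_cases k <;> simp [modelPara_apply]

theorem modelComplex_modelComplex (x : Fin 6 → ℝ) : modelComplex (modelComplex x) = -x := by
  ext k; fin_cases k <;> simp [modelComplex_apply]

theorem modelPara_modelComplex (x : Fin 6 → ℝ) :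
    modelPara (modelComplex x) = -modelComplex (modelPara x) := by
  ext k; fin_cases k <;> simp [modelPara_apply, modelComplex_apply]

theorem modelForm_swap (x y : Fin 6 → ℝ) : modelForm x y = -modelForm y x := by
  simp only [modelForm_apply, wedge]; ring

theorem modelForm_modelPara (x y : Fin 6 → ℝ) :
    modelForm (modelPara x) y = -modelForm x (modelPara y) := by
  simp [modelForm_apply, modelPara_apply, wedge]; ring

theorem modelForm_modelComplex (x y : Fin 6 → ℝ) :
    modelForm (modelComplex x) y = -modelForm x (modelComplex y) := by
  simp [modelForm_apply, modelComplex_apply, wedge]; ring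

theorem modelForm_separating {x : Fin 6 → ℝ} (h : ∀ y, modelForm x y = 0) : x = 0 := by
  have h' (i : Fin 6) := h (Pi.single i 1)
  have h0 := h' 0
  have h1 := h' 1
  have h2 := h' 2
  have h3 := h' 3
  have h4 := h' 4
  have h5 := h' 5
  simp [modelForm_apply, wedge] at h0 h1 h2 h3 h4 h5
  ext k; fin_cases k <;> simp [*]

end Model

section OfCompatible

variable {𝔤 : Type*} [LieRing 𝔤] [LieAlgebra ℝ 𝔤]

theorem nondegenerate_of_swap {V : Type*} [AddCommGroup V] [Module ℝ V]
    {f : LinearMap.BilinForm ℝ V} {c : ℝ} (hf : ∀ x y, f x y = c * f y x)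
    (h : ∀ x, (∀ y, f x y = 0) → x = 0) : f.Nondegenerate :=
  ⟨h, fun y hy => h y fun x => by rw [hf, hy, mul_zero]⟩

/-- The Born structure given by a symplectic form, a para-complex structure and an anticommuting
complex structure for which the form is skew. -/
def BornStructure.ofCompatible (ω : LinearMap.BilinForm ℝ 𝔤) (A J : Module.End ℝ 𝔤)
    (hω : ∀ x y, ω x y = -ω y x) (hω' : ∀ x, (∀ y, ω x y = 0) → x = 0)
    (hA : ∀ x, A (A x) = x) (hJ : ∀ x, J (J x) = -x) (hAJ : ∀ x, A (J x) = -J (A x))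
    (hωA : ∀ x y, ω (A x) y = -ω x (A y)) (hωJ : ∀ x y, ω (J x) y = -ω x (J y)) :
    BornStructure 𝔤 where
  g := ω ∘ₗ A
  h := -(ω ∘ₗ J)
  ω := ω
  g_symm := ⟨fun x y => by simp [hωA x y, hω x]⟩
  g_nondegenerate := by
    refine nondegenerate_of_swap (c := 1) (fun x y => by simp [hωA x y, hω x]) fun x hx => ?_
    rw [← hA x, hω' (A x) hx, map_zero]
  h_symm := ⟨fun x y => by simp [hωJ x y, hω x]⟩
  h_nondegenerate := by
    refine nondegenerate_of_swap (c := 1) (fun x y => by simp [hωJ x y, hω x]) fun x hx => ?_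
    have : J x = 0 := hω' (J x) fun y => by simpa using hx y
    rw [← neg_eq_zero, ← hJ x, this, map_zero]
  ω_alt := fun x => by linarith [hω x x]
  ω_nondegenerate := nondegenerate_of_swap (c := -1) (fun x y => by rw [hω]; ring) hω'
  A := A
  -- Forced by g(BX,Y) = h(X,Y): with g = ω(A·,·) and h = -ω(J·,·) it reads AB = -J, so B = -AJ =
  -- JA.
  B := J ∘ₗ A
  J := J
  recursion_A := fun x y => by simp [hA]
  recursion_B := fun x y => by simp [hAJ, hA]
  recursion_J := fun x y => by simp
  A_sq := LinearMap.ext hA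
  B_sq := LinearMap.ext fun x => by simp [hAJ, hA, hJ]
  J_sq := LinearMap.ext hJ

/-- The Born structure obtained from the model one on `ℝ⁶` along linear coordinates. -/
def BornStructure.ofCoordinates (e : 𝔤 ≃ₗ[ℝ] (Fin 6 → ℝ)) : BornStructure 𝔤 :=
  .ofCompatible (modelForm.compl₁₂ e.toLinearMap e.toLinearMap)
    (e.symm.conj modelPara) (e.symm.conj modelComplex)
    (fun x y => by simpa using modelForm_swap (e x) (e y))
    (fun x hx => by
      rw [← e.map_eq_zero_iff]
      exact modelForm_separating fun y => by simpa using hx (e.symm y))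
    (fun x => by simp [LinearEquiv.conj_apply, modelPara_modelPara])
    (fun x => by simp [LinearEquiv.conj_apply, modelComplex_modelComplex])
    (fun x => by simp [LinearEquiv.conj_apply, modelPara_modelComplex])
    (fun x y => by simp [LinearEquiv.conj_apply, modelForm_modelPara])
    (fun x y => by simp [LinearEquiv.conj_apply, modelForm_modelComplex])

theorem mem_eigenspace_ofCoordinates {e : 𝔤 ≃ₗ[ℝ] (Fin 6 → ℝ)} {c : ℝ} {X : 𝔤} :
    X ∈ (BornStructure.ofCoordinates e).A.eigenspace c ↔ modelPara (e X) = c • e X := by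
  rw [Module.End.mem_eigenspace_iff]
  change e.symm.conj modelPara X = _ ↔ _
  simp [LinearEquiv.conj_apply, LinearEquiv.symm_apply_eq]

/-- The Born structure in coordinates is integrable with abelian eigenspaces as soon as the bracket
in coordinates satisfies the corresponding identities for the model structure. -/
theorem exists_integrable_of_coordinates (e : 𝔤 ≃ₗ[ℝ] (Fin 6 → ℝ))
    (br : (Fin 6 → ℝ) → (Fin 6 → ℝ) → (Fin 6 → ℝ)) (hbr : ∀ X Y, e ⁅X, Y⁆ = br (e X) (e Y))
    (hclosed : ∀ x y z, -modelForm (br x y) z + modelForm (br x z) y - modelForm (br y z) x = 0)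
    (hnij : ∀ x y, br (modelComplex x) (modelComplex y) - modelComplex (br (modelComplex x) y) -
      modelComplex (br x (modelComplex y)) - br x y = 0)
    (hplus : ∀ x y, modelPara x = x → modelPara y = y → br x y = 0)
    (hminus : ∀ x y, modelPara x = -x → modelPara y = -y → br x y = 0) :
    ∃ (S : BornStructure 𝔤) (hS : S.IsIntegrable),
      IsLieAbelian hS.gPlus ∧ IsLieAbelian hS.gMinus := by
  have hp (X Y : 𝔤) (hX : X ∈ (BornStructure.ofCoordinates e).A.eigenspace 1)
      (hY : Y ∈ (BornStructure.ofCoordinates e).A.eigenspace 1) : ⁅X, Y⁆ = 0 := by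
    rw [mem_eigenspace_ofCoordinates, one_smul] at hX hY
    rw [← e.map_eq_zero_iff, hbr, hplus _ _ hX hY]
  have hm (X Y : 𝔤) (hX : X ∈ (BornStructure.ofCoordinates e).A.eigenspace (-1))
      (hY : Y ∈ (BornStructure.ofCoordinates e).A.eigenspace (-1)) : ⁅X, Y⁆ = 0 := by
    rw [mem_eigenspace_ofCoordinates, neg_smul, one_smul] at hX hY
    rw [← e.map_eq_zero_iff, hbr, hminus _ _ hX hY]
  refine ⟨.ofCoordinates e, ⟨fun X Y Z => ?_, fun X Y => ?_, fun X hX Y hY => ?_,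
    fun X hX Y hY => ?_⟩, ⟨fun X Y => ?_⟩, ⟨fun X Y => ?_⟩⟩
  · have := hclosed (e X) (e Y) (e Z)
    rwa [← hbr, ← hbr, ← hbr] at this
  · have := hnij (e X) (e Y)
    rw [← e.map_eq_zero_iff, ← this, nijenhuis]
    change e (⁅e.symm.conj modelComplex X, e.symm.conj modelComplex Y⁆ -
      e.symm.conj modelComplex ⁅e.symm.conj modelComplex X, Y⁆ -
      e.symm.conj modelComplex ⁅X, e.symm.conj modelComplex Y⁆ - ⁅X, Y⁆) = _
    simp [LinearEquiv.conj_apply, hbr]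
  · rw [hp X Y hX hY]; exact zero_mem _
  · rw [hm X Y hX hY]; exact zero_mem _
  · exact Subtype.ext (hp X Y X.2 Y.2)
  · exact Subtype.ext (hm X Y X.2 Y.2)

theorem eq_zero_of_modelPara_eq {x : Fin 6 → ℝ} (h : modelPara x = x) :
    x 1 = 0 ∧ x 2 = 0 ∧ x 3 = 0 := by
  have h1 := congrFun h 1
  have h2 := congrFun h 2
  have h3 := congrFun h 3
  simp [modelPara_apply] at h1 h2 h3
  exact ⟨by linarith, by linarith, by linarith⟩

theorem eq_zero_of_modelPara_eq_neg {x : Fin 6 → ℝ} (h : modelPara x = -x) :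
    x 0 = 0 ∧ x 4 = 0 ∧ x 5 = 0 := by
  have h1 := congrFun h 0
  have h2 := congrFun h 4
  have h3 := congrFun h 5
  simp [modelPara_apply] at h1 h2 h3
  exact ⟨by linarith, by linarith, by linarith⟩

theorem exists_integrable_of_equiv_H8 (e : 𝔤 ≃ₗ⁅ℝ⁆ H8) :
    ∃ (S : BornStructure 𝔤) (hS : S.IsIntegrable),
      IsLieAbelian hS.gPlus ∧ IsLieAbelian hS.gMinus := by
  refine exists_integrable_of_coordinates e.toLinearEquiv H8.bracket (fun X Y => e.map_lie X Y)
    (fun x y z => ?_) (fun x y => ?_) (fun x y hx hy => ?_) fun x y hx hy => ?_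
  · simp [modelForm_apply, H8.bracket, wedge]; ring
  · ext k; fin_cases k <;> simp [modelComplex_apply, H8.bracket, wedge]; ring
  · simp [H8.bracket, wedge, eq_zero_of_modelPara_eq hx, eq_zero_of_modelPara_eq hy]
  · simp [H8.bracket, wedge, eq_zero_of_modelPara_eq_neg hx, eq_zero_of_modelPara_eq_neg hy]

theorem exists_integrable_of_equiv_H9 (e : 𝔤 ≃ₗ⁅ℝ⁆ H9) :
    ∃ (S : BornStructure 𝔤) (hS : S.IsIntegrable),
      IsLieAbelian hS.gPlus ∧ IsLieAbelian hS.gMinus := by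
  refine exists_integrable_of_coordinates e.toLinearEquiv H9.bracket (fun X Y => e.map_lie X Y)
    (fun x y z => ?_) (fun x y => ?_) (fun x y hx hy => ?_) fun x y hx hy => ?_
  · simp [modelForm_apply, H9.bracket, wedge]; ring
  · ext k; fin_cases k <;> simp [modelComplex_apply, H9.bracket, wedge] <;> ring
  · simp [H9.bracket, wedge, eq_zero_of_modelPara_eq hx, eq_zero_of_modelPara_eq hy]
  · simp [H9.bracket, wedge, eq_zero_of_modelPara_eq_neg hx, eq_zero_of_modelPara_eq_neg hy]

end OfCompatible

end BornLie
-- Algebra of Frobenius pairs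
namespace BornLie

/-- Two commutative multiplications `p`, `q` on a three-dimensional space with nilpotent
translations, with a common invariant non-degenerate symmetric form, such that left translations
with respect to any of the two multiplications satisfy `X (Y Z) = Y (X Z)`. -/
structure FrobeniusPair (V : Type*) [AddCommGroup V] [Module ℝ V] where
  finrank_eq : Module.finrank ℝ V = 3
  b : LinearMap.BilinForm ℝ V
  p : V →ₗ[ℝ] V →ₗ[ℝ] V
  q : V →ₗ[ℝ] V →ₗ[ℝ] V
  b_symm : ∀ X Y, b X Y = b Y X
  b_separating : ∀ X, (∀ Y, b X Y = 0) → X = 0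
  p_comm : ∀ X Y, p X Y = p Y X
  q_comm : ∀ X Y, q X Y = q Y X
  p_inv : ∀ X Y Z, b (p X Y) Z = b Y (p X Z)
  q_inv : ∀ X Y Z, b (q X Y) Z = b Y (q X Z)
  pp : ∀ X Y Z, p X (p Y Z) = p Y (p X Z)
  pq : ∀ X Y Z, p X (q Y Z) = p Y (q X Z)
  qp : ∀ X Y Z, q X (p Y Z) = q Y (p X Z)
  qq : ∀ X Y Z, q X (q Y Z) = q Y (q X Z)
  p_nil : ∀ X Y, p X (p X (p X Y)) = 0
  q_nil : ∀ X Y, q X (q X (q X Y)) = 0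

namespace FrobeniusPair

variable {V : Type*} [AddCommGroup V] [Module ℝ V]

/-- The pair `(-q, -p)`. -/
def swap (F : FrobeniusPair V) : FrobeniusPair V where
  finrank_eq := F.finrank_eq
  b := F.b
  p := -F.q
  q := -F.p
  b_symm := F.b_symm
  b_separating := F.b_separating
  p_comm X Y := by simp [F.q_comm X Y]
  q_comm X Y := by simp [F.p_comm X Y]
  p_inv X Y Z := by simp [F.q_inv]
  q_inv X Y Z := by simp [F.p_inv]
  pp X Y Z := by simp [F.qq X]
  pq X Y Z := by simp [F.qp X]
  qp X Y Z := by simp [F.pq X]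
  qq X Y Z := by simp [F.pp X]
  p_nil X Y := by simp [F.q_nil]
  q_nil X Y := by simp [F.p_nil]

variable (F : FrobeniusPair V)

/-- Isotropic subspaces of a non-degenerate three-dimensional space have dimension at most one. -/
theorem exists_smul_of_isotropic {v w : V} (hv : v ≠ 0) (hvv : F.b v v = 0) (hvw : F.b v w = 0)
    (hww : F.b w w = 0) : ∃ c : ℝ, w = c • v := by
  have : FiniteDimensional ℝ V := .of_finrank_pos (by rw [F.finrank_eq]; norm_num)
  by_contra! hc
  have hli : LinearIndependent ℝ ![v, w] := by
    rw [LinearIndependent.pair_iff' hv]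
    exact fun a ha => hc a ha.symm
  -- Non-degeneracy makes this map onto, so its kernel is a line; but isotropy puts both v and w in
  -- the kernel.
  let f : V →ₗ[ℝ] (Fin 2 → ℝ) := LinearMap.pi ![F.b v, F.b w]
  have hker : 2 ≤ Module.finrank ℝ (LinearMap.ker f) := by
    have hle : Submodule.span ℝ (Set.range ![v, w]) ≤ LinearMap.ker f := by
      rw [Submodule.span_le]
      rintro _ ⟨i, rfl⟩
      refine funext fun j => ?_
      fin_cases i <;> fin_cases j <;> simp [f, hvv, hvw, hww, F.b_symm w v]
    have := Submodule.finrank_mono hle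
    rwa [finrank_span_eq_card hli, Fintype.card_fin] at this
  have hrange : LinearMap.range f = ⊤ := by
    by_contra hne
    obtain ⟨φ, hφ, hφ'⟩ := Submodule.exists_le_ker_of_lt_top _ (lt_top_iff_ne_top.2 hne)
    have hz : φ (Pi.single 0 1) • v + φ (Pi.single 1 1) • w = 0 := by
      refine F.b_separating _ fun Y => ?_
      have h : φ (f Y) = 0 := hφ' ⟨Y, rfl⟩
      have hf : f Y = F.b v Y • Pi.single 0 1 + F.b w Y • Pi.single 1 1 := by
        ext j; fin_cases j <;> simp [f]
      rw [hf] at h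
      simp at h ⊢
      linarith
    obtain ⟨h0, h1⟩ := LinearIndependent.pair_iff.1 hli _ _ hz
    refine hφ (LinearMap.pi_ext' fun i => ?_)
    ext
    fin_cases i <;> simpa
  have := f.finrank_range_add_finrank_ker
  rw [hrange, finrank_top, F.finrank_eq] at this
  simp at this
  omega

/-- Polarization: a symmetric trilinear map that vanishes on the diagonal vanishes. -/
theorem eq_zero_of_diagonal {s t : V →ₗ[ℝ] V →ₗ[ℝ] V} (ht : ∀ X Y, t X Y = t Y X)
    (hst : ∀ X Y Z, s X (t Y Z) = s Y (t X Z)) (h : ∀ X, s X (t X X) = 0) (X Y Z : V) :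
    s X (t Y Z) = 0 := by
  have h2 (X Y : V) : s X (t X Y) = 0 := by
    -- The cubes of X + Y and X - Y differ by 6 X²Y + 2 Y³, and Y³ = 0.
    have e1 := h (X + Y)
    have e2 := h (X - Y)
    simp only [map_add, map_sub, LinearMap.add_apply, LinearMap.sub_apply, h, hst Y X,
      ht Y X] at e1 e2
    have e3 := hst X Y Y
    rw [e3] at e1 e2
    have : (6 : ℝ) • s X (t X Y) = 0 := by
      refine Eq.trans ?_ ((congrArg₂ (· - ·) e1 e2).trans (sub_zero 0))
      module
    simpa using this
  have e1 := h2 (X + Y) Z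
  simp only [map_add, LinearMap.add_apply, h2, hst Y X] at e1
  have : (2 : ℝ) • s X (t Y Z) = 0 := by
    rw [← e1]
    module
  simpa using this

/-- By polarization it suffices to treat a = p(x, q(x,x)). Both a and q(x,x) are isotropic and they
are orthogonal, so if a ≠ 0 then q(x,x) is a multiple of a; applying p(x,·) to it then gives zero,
because p(x,a) is already zero. -/
theorem pq_eq_zero (hp : ∀ X Y Z, F.p X (F.p Y Z) = 0) (hq : ∀ X Y Z, F.q X (F.q Y Z) = 0)
    (X Y Z : V) : F.p X (F.q Y Z) = 0 := by
  refine eq_zero_of_diagonal F.q_comm F.pq (fun x => ?_) X Y Z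
  by_contra hne
  obtain ⟨c, hc⟩ := F.exists_smul_of_isotropic (w := F.q x x) hne
    (by rw [F.p_inv, hp, map_zero])
    (by rw [F.p_comm, F.p_inv, F.pq, F.q_comm _ x, hq, map_zero, map_zero])
    (by rw [F.q_inv, hq, map_zero])
  apply hne
  rw [hc, map_smul, hp, smul_zero]

section LongCase

variable {F} {x : V} (hx : F.p x (F.p x x) ≠ 0)
include hx

theorem linearIndependent_pow : LinearIndependent ℝ ![x, F.p x x, F.p x (F.p x x)] := by
  rw [Fintype.linearIndependent_iff]
  intro c hc
  simp only [Fin.sum_univ_three, Matrix.cons_val] at hc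
  have h0 : c 0 = 0 := by
    have := congrArg (fun Z => F.p x (F.p x Z)) hc
    simpa [F.p_nil, hx] using this
  have h1 : c 1 = 0 := by
    have := congrArg (F.p x) hc
    simpa [F.p_nil, hx, h0] using this
  have h2 : c 2 = 0 := by simpa [hx, h0, h1] using hc
  intro i; fin_cases i <;> assumption

theorem exists_eq_pow (Z : V) :
    ∃ c : Fin 3 → ℝ, Z = c 0 • x + c 1 • F.p x x + c 2 • F.p x (F.p x x) := by
  let B := basisOfLinearIndependentOfCardEqFinrank (linearIndependent_pow hx)
    (by simp [F.finrank_eq])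
  refine ⟨B.repr Z, ?_⟩
  conv_lhs => rw [← B.sum_repr Z]
  simp [Fin.sum_univ_three, B]

/-- By invariance x³ is orthogonal to x² and to itself, so non-degeneracy leaves only x to pair with
it. -/
theorem b_pow_ne_zero : F.b x (F.p x (F.p x x)) ≠ 0 := by
  intro h
  refine hx (F.b_separating _ fun Z => ?_)
  obtain ⟨c, rfl⟩ := exists_eq_pow hx Z
  have h1 : F.b (F.p x x) (F.p x (F.p x x)) = 0 := by rw [F.p_inv, F.p_nil, map_zero]
  have h2 : F.b (F.p x (F.p x x)) (F.p x (F.p x x)) = 0 := by rw [F.p_inv, F.p_nil, map_zero]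
  rw [F.b_symm]
  simp [h, h1, h2]

theorem exists_smul_of_mul_eq_zero {Z : V} (hZ : F.p x Z = 0) :
    ∃ c : ℝ, Z = c • F.p x (F.p x x) := by
  obtain ⟨c, rfl⟩ := exists_eq_pow hx Z
  have h0 : c 0 = 0 := by
    have := congrArg (F.p x) hZ
    simpa [F.p_nil, hx] using this
  have h1 : c 1 = 0 := by simpa [F.p_nil, hx, h0] using hZ
  exact ⟨c 2, by simp [h0, h1]⟩

omit hx in
theorem p_cube (Z : V) : F.p (F.p x (F.p x x)) Z = 0 := by
  rw [F.p_comm, F.pp, F.pp Z x x, F.p_comm Z x, F.p_nil]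

/-- The exchange law puts q(x³,Z) in the kernel of p(x,·), which is the line of x³. Thus x³ is an
eigenvector of the nilpotent map q(Z,·), with eigenvalue zero. -/
theorem q_cube (Z : V) : F.q (F.p x (F.p x x)) Z = 0 := by
  obtain ⟨c, hc⟩ := exists_smul_of_mul_eq_zero hx (Z := F.q (F.p x (F.p x x)) Z)
    (by rw [F.pq, p_cube])
  have h := F.q_nil Z (F.p x (F.p x x))
  rw [F.q_comm] at hc
  simp only [hc, map_smul, smul_smul, smul_eq_zero, hx, or_false] at h
  rw [F.q_comm, hc, show c = 0 by simpa using h, zero_smul]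

/-- Pairing q(x,x) with x³ gives b(x, q(x,x³)) = 0, and this pairing detects exactly the coefficient
of x. -/
theorem exists_q_self : ∃ α β : ℝ, F.q x x = α • F.p x x + β • F.p x (F.p x x) := by
  obtain ⟨c, hc⟩ := exists_eq_pow hx (F.q x x)
  have h : F.b (F.q x x) (F.p x (F.p x x)) = 0 := by
    rw [F.q_inv, F.q_comm, q_cube hx, map_zero]
  have h1 : F.b (F.p x x) (F.p x (F.p x x)) = 0 := by rw [F.p_inv, F.p_nil, map_zero]
  have h2 : F.b (F.p x (F.p x x)) (F.p x (F.p x x)) = 0 := by rw [F.p_inv, F.p_nil, map_zero]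
  have h0 : c 0 = 0 := by
    rw [hc] at h
    simpa [h1, h2, b_pow_ne_zero hx] using h
  exact ⟨c 1, c 2, by rw [hc, h0, zero_smul, zero_add]⟩

omit hx in
theorem p_square_square : F.p (F.p x x) (F.p x x) = 0 := by
  rw [F.pp, F.p_comm _ x, F.p_nil]

theorem q_square_square : F.q (F.p x x) (F.p x x) = 0 := by
  rw [F.qp, F.p_comm _ x, F.q_comm, q_cube hx]

theorem exists_q_square : ∃ γ : ℝ, F.q x (F.p x x) = γ • F.p x (F.p x x) := by
  obtain ⟨α, β, h⟩ := exists_q_self hx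
  refine exists_smul_of_mul_eq_zero hx ?_
  rw [F.q_comm, F.pq, h, map_add, map_smul, map_smul, p_square_square, F.p_comm, p_cube]
  simp

end LongCase

/-- A commutative invariant multiplication with values in a line is the square of a functional. -/
theorem eq_smul_of_mem_line {s : V →ₗ[ℝ] V →ₗ[ℝ] V} (hs : ∀ X Y, s X Y = s Y X)
    (hinv : ∀ X Y Z, F.b (s X Y) Z = F.b Y (s X Z)) {u v : V} (huv : F.b v u = 1)
    (h : ∀ X Y, ∃ c : ℝ, s X Y = c • v) (X Y : V) :
    s X Y = (F.b v X * F.b v Y) • s u u := by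
  choose c hc using h
  -- Invariance paired against u separates the variable Y; commutativity then separates X.
  have key (X Y : V) : c X Y = c X u * F.b v Y := by
    have := hinv X Y u
    simpa [hc, huv, F.b_symm Y] using this
  have hcomm : c X u = c u X := by
    have := congrArg (fun Z => F.b Z u) (hs X u)
    simpa [hc, huv] using this
  rw [hc X, hc u, smul_smul, key X Y, hcomm, key u X]
  congr 1; ring

/-- If all products of three elements vanish, both multiplications are multiples of the square of
the functional of an isotropic vector, with values in the line of that vector. -/
theorem exists_rank_one (hp : ∀ X Y Z, F.p X (F.p Y Z) = 0) (hq : ∀ X Y Z, F.q X (F.q Y Z) = 0)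
    (hne : ∃ X Y, F.p X Y ≠ 0 ∨ F.q X Y ≠ 0) :
    ∃ (u v : V) (r s : ℝ), F.b v v = 0 ∧ F.b v u = 1 ∧ (r ≠ 0 ∨ s ≠ 0) ∧
      (∀ X Y, F.p X Y = (F.b v X * F.b v Y) • r • v) ∧
      ∀ X Y, F.q X Y = (F.b v X * F.b v Y) • s • v := by
  have hpq := F.pq_eq_zero hp hq
  have hqp (X Y Z : V) : F.q X (F.p Y Z) = 0 := by
    have := F.swap.pq_eq_zero (fun X Y Z => by simp [swap, hq]) (fun X Y Z => by simp [swap, hp])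
      X Y Z
    simpa [swap] using this
  obtain ⟨v, hv, hvv, hpv, hqv⟩ : ∃ v, v ≠ 0 ∧ F.b v v = 0 ∧ (∀ X Y, F.b v (F.p X Y) = 0) ∧
      ∀ X Y, F.b v (F.q X Y) = 0 := by
    obtain ⟨X, Y, h | h⟩ := hne
    · exact ⟨_, h, by simp [F.p_inv, hp], by simp [F.p_inv, hp], by simp [F.p_inv, hpq]⟩
    · exact ⟨_, h, by simp [F.q_inv, hq], by simp [F.q_inv, hqp], by simp [F.q_inv, hq]⟩
  obtain ⟨u, huv⟩ : ∃ u, F.b v u = 1 := by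
    by_contra! hu
    refine hv (F.b_separating v fun Y => ?_)
    by_contra hY
    exact hu ((F.b v Y)⁻¹ • Y) (by simp [hY])
  have hpl (X Y : V) : ∃ c : ℝ, F.p X Y = c • v :=
    F.exists_smul_of_isotropic hv hvv (hpv X Y) (by simp [F.p_inv, hp])
  have hql (X Y : V) : ∃ c : ℝ, F.q X Y = c • v :=
    F.exists_smul_of_isotropic hv hvv (hqv X Y) (by simp [F.q_inv, hq])
  obtain ⟨r, hr⟩ := hpl u u
  obtain ⟨s, hs⟩ := hql u u
  have hP := F.eq_smul_of_mem_line F.p_comm F.p_inv huv hpl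
  have hQ := F.eq_smul_of_mem_line F.q_comm F.q_inv huv hql
  rw [hr] at hP
  rw [hs] at hQ
  refine ⟨u, v, r, s, hvv, huv, ?_, hP, hQ⟩
  by_contra! h
  obtain ⟨X, Y, hXY⟩ := hne
  simp [hP, hQ, h] at hXY

end FrobeniusPair
end BornLie
-- From Frobenius pairs to the two algebras
namespace BornLie

section Recognition

variable {𝔤 𝔥 : Type*} [LieRing 𝔤] [LieAlgebra ℝ 𝔤] [LieRing 𝔥] [LieAlgebra ℝ 𝔥]

/-- A linear map preserves brackets if it does so on ordered pairs of basis vectors. -/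
theorem map_lie_of_basis {ι : Type*} [LinearOrder ι] (f : Module.Basis ι ℝ 𝔤) (φ : 𝔤 →ₗ[ℝ] 𝔥)
    (h : ∀ i j, i < j → φ ⁅f i, f j⁆ = ⁅φ (f i), φ (f j)⁆) (X Y : 𝔤) :
    φ ⁅X, Y⁆ = ⁅φ X, φ Y⁆ := by
  have h' (i j : ι) : φ ⁅f i, f j⁆ = ⁅φ (f i), φ (f j)⁆ := by
    rcases lt_trichotomy i j with hij | rfl | hij
    · exact h i j hij
    · simp
    · rw [← lie_skew, map_neg, h j i hij, lie_skew]
  have key : (LieModule.toEnd ℝ 𝔤 𝔤 : 𝔤 →ₗ[ℝ] Module.End ℝ 𝔤).compr₂ φ =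
      (LieModule.toEnd ℝ 𝔥 𝔥 : 𝔥 →ₗ[ℝ] Module.End ℝ 𝔥).compl₁₂ φ φ :=
    f.ext fun i => f.ext fun j => by simpa using h' i j
  simpa using LinearMap.congr_fun₂ key X Y

theorem nonempty_equiv_H8 (f : Module.Basis (Fin 6) ℝ 𝔤) (h01 : ⁅f 0, f 1⁆ = -f 5)
    (h : ∀ i j, i < j → (i, j) ≠ (0, 1) → ⁅f i, f j⁆ = 0) : Nonempty (𝔤 ≃ₗ⁅ℝ⁆ H8) := by
  let φ : 𝔤 ≃ₗ[ℝ] H8 := f.equivFun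
  have hφ (i : Fin 6) : φ (f i) = (Pi.single i 1 : Fin 6 → ℝ) := by
    change f.equivFun (f i) = _
    ext j; simp [Module.Basis.equivFun_self, Pi.single_apply, eq_comm]
  refine ⟨{ φ with
    map_lie' := fun {X Y} => map_lie_of_basis f φ.toLinearMap (fun i j hij => ?_) X Y }⟩
  change φ ⁅f i, f j⁆ = ⁅φ (f i), φ (f j)⁆
  have hlie : ⁅φ (f i), φ (f j)⁆ = H8.bracket (φ (f i)) (φ (f j)) := rfl
  rw [hlie, hφ, hφ]
  by_cases hc : (i, j) = (0, 1)
  · obtain ⟨rfl, rfl⟩ := Prod.mk.inj hc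
    rw [h01, map_neg, hφ]
    change -(Pi.single 5 1 : Fin 6 → ℝ) = _
    ext k; fin_cases k <;> simp [H8.bracket, wedge]
  · rw [h i j hij hc, map_zero]
    change (0 : Fin 6 → ℝ) = _
    fin_cases i <;> fin_cases j <;> simp [H8.bracket, wedge] at hij hc ⊢ <;>
      (ext k; fin_cases k <;> rfl)

theorem nonempty_equiv_H9 (f : Module.Basis (Fin 6) ℝ 𝔤) (h01 : ⁅f 0, f 1⁆ = -f 4)
    (h03 : ⁅f 0, f 3⁆ = -f 5) (h14 : ⁅f 1, f 4⁆ = -f 5)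
    (h : ∀ i j, i < j → (i, j) ≠ (0, 1) → (i, j) ≠ (0, 3) → (i, j) ≠ (1, 4) → ⁅f i, f j⁆ = 0) :
    Nonempty (𝔤 ≃ₗ⁅ℝ⁆ H9) := by
  let φ : 𝔤 ≃ₗ[ℝ] H9 := f.equivFun
  have hφ (i : Fin 6) : φ (f i) = (Pi.single i 1 : Fin 6 → ℝ) := by
    change f.equivFun (f i) = _
    ext j; simp [Module.Basis.equivFun_self, Pi.single_apply, eq_comm]
  refine ⟨{ φ with
    map_lie' := fun {X Y} => map_lie_of_basis f φ.toLinearMap (fun i j hij => ?_) X Y }⟩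
  change φ ⁅f i, f j⁆ = ⁅φ (f i), φ (f j)⁆
  have hlie : ⁅φ (f i), φ (f j)⁆ = H9.bracket (φ (f i)) (φ (f j)) := rfl
  rw [hlie, hφ, hφ]
  by_cases hc : (i, j) = (0, 1)
  · obtain ⟨rfl, rfl⟩ := Prod.mk.inj hc
    rw [h01, map_neg, hφ]
    change -(Pi.single 4 1 : Fin 6 → ℝ) = _
    ext k; fin_cases k <;> simp [H9.bracket, wedge]
  by_cases hc' : (i, j) = (0, 3)
  · obtain ⟨rfl, rfl⟩ := Prod.mk.inj hc'
    rw [h03, map_neg, hφ]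
    change -(Pi.single 5 1 : Fin 6 → ℝ) = _
    ext k; fin_cases k <;> simp [H9.bracket, wedge]
  by_cases hc'' : (i, j) = (1, 4)
  · obtain ⟨rfl, rfl⟩ := Prod.mk.inj hc''
    rw [h14, map_neg, hφ]
    change -(Pi.single 5 1 : Fin 6 → ℝ) = _
    ext k; fin_cases k <;> simp [H9.bracket, wedge]
  · rw [h i j hij hc hc' hc'', map_zero]
    change (0 : Fin 6 → ℝ) = _
    fin_cases i <;> fin_cases j <;> simp [H9.bracket, wedge] at hij hc hc' hc'' ⊢ <;>
      (ext k; fin_cases k <;> rfl)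

end Recognition

/-- The linear coordinates `e : V × V ≃ 𝔤` identify `𝔤` with the sum of two abelian subalgebras
whose mutual brackets are given by the two multiplications of a Frobenius pair. -/
structure FrobeniusPair.IsDouble {V 𝔤 : Type*} [AddCommGroup V] [Module ℝ V] [LieRing 𝔤]
    [LieAlgebra ℝ 𝔤] (F : FrobeniusPair V) (e : (V × V) ≃ₗ[ℝ] 𝔤) : Prop where
  fst_fst : ∀ X Y, ⁅e (X, 0), e (Y, 0)⁆ = 0
  snd_snd : ∀ X Y, ⁅e (0, X), e (0, Y)⁆ = 0
  fst_snd : ∀ X Y, ⁅e (X, 0), e (0, Y)⁆ = e (F.p X Y, F.q X Y)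

namespace FrobeniusPair

variable {V 𝔤 : Type*} [AddCommGroup V] [Module ℝ V] [LieRing 𝔤] [LieAlgebra ℝ 𝔤]
  {F : FrobeniusPair V} {e : (V × V) ≃ₗ[ℝ] 𝔤}

/-- Exchanging the summands reverses the mixed bracket, hence the signs in `FrobeniusPair.swap`. -/
theorem IsDouble.swap (h : F.IsDouble e) :
    F.swap.IsDouble ((LinearEquiv.prodComm ℝ V V).trans e) where
  fst_fst X Y := by simpa using h.snd_snd X Y
  snd_snd X Y := by simpa using h.fst_fst X Y
  fst_snd X Y := by
    have := h.fst_snd Y X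
    rw [← lie_skew, neg_eq_iff_eq_neg, ← map_neg] at this
    simpa [FrobeniusPair.swap, F.p_comm X Y, F.q_comm X Y] using this

theorem IsDouble.lie (h : F.IsDouble e) (X X' Y Y' : V) :
    ⁅e (X, X'), e (Y, Y')⁆ = e (F.p X Y' - F.p X' Y, F.q X Y' - F.q X' Y) := by
  have hs (Z Z' : V) : e (Z, Z') = e (Z, 0) + e (0, Z') := by rw [← map_add]; simp
  rw [hs X, hs Y, add_lie, lie_add, lie_add, h.fst_fst, h.snd_snd, h.fst_snd,
    ← lie_skew (e (0, X')), h.fst_snd, ← map_neg, zero_add, add_zero, ← map_add, F.p_comm X' Y,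
    F.q_comm X' Y]
  simp [sub_eq_add_neg]

theorem IsDouble.lie_eq_zero (h : F.IsDouble e) {Z W : V × V} (hp : F.p Z.1 W.2 = F.p Z.2 W.1)
    (hq : F.q Z.1 W.2 = F.q Z.2 W.1) : ⁅e Z, e W⁆ = 0 := by
  rw [h.lie Z.1 Z.2 W.1 W.2, hp, hq, sub_self, sub_self, Prod.mk_zero_zero, map_zero]

theorem finrank_of_coordinates (F : FrobeniusPair V) (e : (V × V) ≃ₗ[ℝ] 𝔤) :
    Module.finrank ℝ 𝔤 = 6 := by
  have : FiniteDimensional ℝ V := .of_finrank_pos (by rw [F.finrank_eq]; norm_num)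
  rw [← e.finrank_eq, Module.finrank_prod, F.finrank_eq]

theorem IsDouble.nonempty_equiv_H9 (h : F.IsDouble e) {x : V} (hx : F.p x (F.p x x) ≠ 0) :
    Nonempty (𝔤 ≃ₗ⁅ℝ⁆ H9) := by
  obtain ⟨α, β, hq⟩ := exists_q_self hx
  obtain ⟨γ, hγ⟩ := exists_q_square hx
  have hpw := F.p_nil x x
  have hpw' := F.p_cube (x := x)
  have hqw' := q_cube hx
  have hpyy := F.p_square_square (x := x)
  have hqyy := q_square_square hx
  have hqw : F.q x (F.p x (F.p x x)) = 0 := by rw [F.q_comm, hqw']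
  have hpyw : F.p (F.p x x) (F.p x (F.p x x)) = 0 := by rw [F.p_comm, hpw']
  have hqyw : F.q (F.p x x) (F.p x (F.p x x)) = 0 := by rw [F.q_comm, hqw']
  have hli := linearIndependent_pow hx
  rw [Fintype.linearIndependent_iff] at hli
  -- The shift by αx in the first vector makes it commute with the fifth, since p(x, q(x,x)) = αx³.
  -- The last two vectors are minus the brackets of the first with the second and with the fourth.
  let f : Fin 6 → V × V := ![(x, α • x), (0, x), (0, F.p x (F.p x x)), (0, F.p x x),
    (-F.p x x, -F.q x x), (-F.p x (F.p x x), -F.q x (F.p x x))]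
  have hf : LinearIndependent ℝ (fun i => e (f i)) := by
    refine LinearIndependent.map' (v := f) ?_ e.toLinearMap e.ker
    rw [Fintype.linearIndependent_iff]
    intro c hc
    simp only [Fin.sum_univ_six, f, Matrix.cons_val, Prod.smul_mk, Prod.mk_add_mk, Prod.mk_eq_zero,
      hq, hγ] at hc
    have h1 := hli ![c 0, -c 4, -c 5] (by
      rw [← hc.1]; simp only [Fin.sum_univ_three, Matrix.cons_val]; module)
    have h10 := h1 0
    have h11 := h1 1
    have h12 := h1 2
    simp at h10 h11 h12
    have h2 := hli ![c 1, c 3, c 2] (by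
      rw [← hc.2]; simp only [Fin.sum_univ_three, Matrix.cons_val, h10, h11, h12]; module)
    have h20 := h2 0
    have h21 := h2 1
    have h22 := h2 2
    simp at h20 h21 h22
    intro i; fin_cases i <;> assumption
  let B := basisOfLinearIndependentOfCardEqFinrank hf
    (by rw [Fintype.card_fin, F.finrank_of_coordinates e])
  have hB (i : Fin 6) : B i = e (f i) := by simp [B]
  refine BornLie.nonempty_equiv_H9 B ?_ ?_ ?_ ?_
  · simp [hB, f, h.lie, ← map_neg]
  · simp [hB, f, h.lie, ← map_neg]
  · simp [hB, f, h.lie, ← map_neg]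
  · intro i j hij h1 h2 h3
    rw [hB, hB]
    apply h.lie_eq_zero <;> fin_cases i <;> fin_cases j <;>
      first
      | exact absurd hij (by decide)
      | exact absurd rfl h1
      | exact absurd rfl h2
      | exact absurd rfl h3
      | simp [f, hq, hγ, hpw, hpw', hqw', hpyy, hqyy, hqw, hpyw, hqyw]

theorem exists_linearIndependent (F : FrobeniusPair V) {u v : V} (hvv : F.b v v = 0)
    (hvu : F.b v u = 1) : ∃ w, F.b v w = 0 ∧ LinearIndependent ℝ ![u, v, w] := by
  have hspan : Submodule.span ℝ {u, v} ≠ ⊤ := by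
    intro htop
    have h := finrank_span_finset_le_card (R := ℝ) (M := V) (Finset.cons u {v} (by
      rw [Finset.mem_singleton]; rintro rfl; simp [hvv] at hvu))
    rw [Finset.coe_cons, Finset.coe_singleton, Set.finrank, htop, finrank_top, F.finrank_eq] at h
    simp at h
  obtain ⟨w, -, hw⟩ := SetLike.exists_of_lt (lt_top_iff_ne_top.2 hspan)
  rw [Submodule.mem_span_pair] at hw
  push Not at hw
  refine ⟨w - F.b v w • u, by simp [hvu], ?_⟩
  rw [Fintype.linearIndependent_iff]
  intro c hc
  simp only [Fin.sum_univ_three, Matrix.cons_val] at hc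
  have h0 : c 0 = 0 := by simpa [hvv, hvu] using congrArg (F.b v) hc
  have h2 : c 2 = 0 := by
    by_contra h2
    refine hw (F.b v w) (-((c 2)⁻¹ * c 1)) ?_
    have : (c 2)⁻¹ • (c 0 • u + c 1 • v + c 2 • (w - F.b v w • u)) = 0 := by rw [hc, smul_zero]
    rw [h0, smul_add, smul_smul _ (c 2), inv_mul_cancel₀ h2] at this
    rw [← sub_eq_zero, ← neg_eq_zero, ← this]
    module
  have h1 : c 1 = 0 := by
    rw [h0, h2, zero_smul, zero_smul, zero_add, add_zero, smul_eq_zero] at hc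
    refine hc.resolve_right ?_
    rintro rfl
    simp at hvu
  intro i; fin_cases i <;> assumption

theorem IsDouble.nonempty_equiv_H8 (h : F.IsDouble e) {u v : V} {r s : ℝ} (hvv : F.b v v = 0)
    (hvu : F.b v u = 1) (hrs : r ≠ 0 ∨ s ≠ 0)
    (hp : ∀ X Y, F.p X Y = (F.b v X * F.b v Y) • r • v)
    (hq : ∀ X Y, F.q X Y = (F.b v X * F.b v Y) • s • v) : Nonempty (𝔤 ≃ₗ⁅ℝ⁆ H8) := by
  obtain ⟨w, hvw, hli⟩ := F.exists_linearIndependent hvv hvu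
  rw [Fintype.linearIndependent_iff] at hli
  have hrs' : r ^ 2 + s ^ 2 ≠ 0 := by
    rcases hrs with h | h <;> positivity
  -- The last vector is minus the bracket of the first two; the fifth completes it to a basis of ℝv
  -- ⊕ ℝv, with determinant r² + s².
  let f : Fin 6 → V × V := ![(u, 0), (0, u), (w, 0), (0, w), (-s • v, r • v), (-r • v, -s • v)]
  have hf : LinearIndependent ℝ (fun i => e (f i)) := by
    refine LinearIndependent.map' (v := f) ?_ e.toLinearMap e.ker
    rw [Fintype.linearIndependent_iff]
    intro c hc
    simp only [Fin.sum_univ_six, f, Matrix.cons_val, Prod.smul_mk, Prod.mk_add_mk,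
      Prod.mk_eq_zero] at hc
    have h1 := hli ![c 0, -s * c 4 - r * c 5, c 2] (by
      rw [← hc.1]; simp only [Fin.sum_univ_three, Matrix.cons_val]; module)
    have h2 := hli ![c 1, r * c 4 - s * c 5, c 3] (by
      rw [← hc.2]; simp only [Fin.sum_univ_three, Matrix.cons_val]; module)
    have h10 : c 0 = 0 := h1 0
    have h11 : -s * c 4 - r * c 5 = 0 := h1 1
    have h12 : c 2 = 0 := h1 2
    have h20 : c 1 = 0 := h2 0
    have h21 : r * c 4 - s * c 5 = 0 := h2 1
    have h22 : c 3 = 0 := h2 2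
    have h4 : c 4 = 0 := (mul_eq_zero_iff_left hrs').1 (by linear_combination r * h21 - s * h11)
    have h5 : c 5 = 0 := (mul_eq_zero_iff_left hrs').1 (by linear_combination -r * h11 - s * h21)
    intro i; fin_cases i <;> assumption
  let B := basisOfLinearIndependentOfCardEqFinrank hf
    (by rw [Fintype.card_fin, F.finrank_of_coordinates e])
  have hB (i : Fin 6) : B i = e (f i) := by simp [B]
  refine BornLie.nonempty_equiv_H8 B ?_ ?_
  · simp [hB, f, h.lie, ← map_neg, hp, hq, hvu]
  · intro i j hij h1
    rw [hB, hB]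
    apply h.lie_eq_zero <;> fin_cases i <;> fin_cases j <;>
      first
      | exact absurd hij (by decide)
      | exact absurd rfl h1
      | simp [f, hp, hq, hvv, hvu, hvw]

theorem IsDouble.nonempty_equiv (h : F.IsDouble e) (hna : ¬ IsLieAbelian 𝔤) :
    Nonempty (𝔤 ≃ₗ⁅ℝ⁆ H8) ∨ Nonempty (𝔤 ≃ₗ⁅ℝ⁆ H9) := by
  by_cases hp : ∃ x, F.p x (F.p x x) ≠ 0
  · exact .inr (h.nonempty_equiv_H9 hp.choose_spec)
  by_cases hq : ∃ x, F.q x (F.q x x) ≠ 0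
  · obtain ⟨x, hx⟩ := hq
    exact .inr (h.swap.nonempty_equiv_H9 (x := x) (by simpa [FrobeniusPair.swap] using hx))
  push Not at hp hq
  obtain ⟨u, v, r, s, hvv, hvu, hrs, hP, hQ⟩ := F.exists_rank_one
    (eq_zero_of_diagonal F.p_comm F.pp hp) (eq_zero_of_diagonal F.q_comm F.qq hq) (by
      by_contra! hall
      refine hna ⟨fun X Y => ?_⟩
      obtain ⟨⟨X, X'⟩, rfl⟩ := e.surjective X
      obtain ⟨⟨Y, Y'⟩, rfl⟩ := e.surjective Y
      simp [h.lie, hall])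
  exact .inl (h.nonempty_equiv_H8 hvv hvu hrs hP hQ)

end FrobeniusPair
end BornLie
-- From Born structures to Frobenius pairs
namespace BornLie

/-- An endomorphism of a three-dimensional space that is a quotient of a nilpotent one has
vanishing cube. -/
theorem apply_three_eq_zero_of_isNilpotent {V W : Type*} [AddCommGroup V] [Module ℝ V]
    [AddCommGroup W] [Module ℝ W] (hV : Module.finrank ℝ V = 3) {a : Module.End ℝ W}
    (ha : IsNilpotent a) {l : Module.End ℝ V} {φ : W →ₗ[ℝ] V} (hφ : Function.Surjective φ)
    (h : ∀ w, φ (a w) = l (φ w)) (Y : V) : l (l (l Y)) = 0 := by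
  have : FiniteDimensional ℝ V := .of_finrank_pos (by rw [hV]; norm_num)
  obtain ⟨n, hn⟩ := ha
  have hpow (n : ℕ) (w : W) : φ ((a ^ n) w) = (l ^ n) (φ w) := by
    induction n with
    | zero => simp
    | succ n ih => rw [pow_succ', pow_succ', Module.End.mul_apply, h, ih, Module.End.mul_apply]
  have hl : IsNilpotent l := ⟨n, LinearMap.ext fun v => by
    obtain ⟨w, rfl⟩ := hφ v
    rw [← hpow, hn]; simp⟩
  -- Cayley–Hamilton: a nilpotent endomorphism in dimension three has characteristic polynomial X³.
  have hc := l.aeval_self_charpoly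
  rw [hl.charpoly_eq_X_pow_finrank, hV, map_pow, Polynomial.aeval_X] at hc
  simpa [pow_succ] using LinearMap.congr_fun hc Y

namespace BornStructure

variable {𝔤 : Type*} [LieRing 𝔤] [LieAlgebra ℝ 𝔤] (S : BornStructure 𝔤)

theorem A_A (X : 𝔤) : S.A (S.A X) = X := LinearMap.congr_fun S.A_sq X

theorem B_B (X : 𝔤) : S.B (S.B X) = X := LinearMap.congr_fun S.B_sq X

theorem J_J (X : 𝔤) : S.J (S.J X) = -X := LinearMap.congr_fun S.J_sq X

theorem ω_swap (X Y : 𝔤) : S.ω X Y = -S.ω Y X := (S.ω_alt.neg_eq Y X).symm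

theorem ω_A (X Y : 𝔤) : S.ω (S.A X) Y = -S.ω X (S.A Y) := by
  rw [S.ω_swap X, neg_neg, ← S.recursion_A, ← S.recursion_A, A_A, A_A, S.g_symm.eq]

theorem ω_J_symm (X Y : 𝔤) : S.ω (S.J X) Y = S.ω (S.J Y) X := by
  have h1 := S.recursion_J X Y
  have h2 := S.recursion_J Y X
  rw [S.h_symm.eq Y X, ← h1] at h2
  simpa using h2.symm

theorem B_eq (X : 𝔤) : S.B X = -S.A (S.J X) := by
  rw [← sub_eq_zero]
  refine S.g_nondegenerate.1 _ fun Y => ?_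
  rw [map_sub, LinearMap.sub_apply, S.recursion_B, ← map_neg, S.recursion_A, ← S.recursion_J]
  simp

/-- Since B = -AJ, the relation B² = 1 reads AJAJ = 1, and the squares of `A` and `J` do the rest.
-/
theorem A_J (X : 𝔤) : S.A (S.J X) = -S.J (S.A X) := by
  have h := congrArg S.J (congrArg S.A (S.B_B X))
  simp only [B_eq, map_neg, neg_neg, A_A, J_J] at h
  rw [← h, neg_neg]

/-- The `+1`-eigenspace of `A`. -/
abbrev plus : Submodule ℝ 𝔤 := S.A.eigenspace 1

theorem A_plus (X : S.plus) : S.A X = X := by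
  simpa using Module.End.mem_eigenspace_iff.1 X.2

theorem J_mem_minus (X : S.plus) : S.J X ∈ S.A.eigenspace (-1) := by
  rw [Module.End.mem_eigenspace_iff, A_J, A_plus]; simp

theorem ω_plus_plus (X Y : S.plus) : S.ω X Y = 0 := by
  have := S.ω_A X Y
  rw [A_plus, A_plus] at this
  linarith

theorem ω_J_J (X Y : S.plus) : S.ω (S.J X) (S.J Y) = 0 := by
  have := S.ω_A (S.J X) (S.J Y)
  rw [A_J, A_plus, A_J, A_plus] at this
  simp at this
  linarith

/-- The decomposition of the Lie algebra as the sum of the `+1`-eigenspace of `A` and its image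
under `J`. -/
noncomputable def splitting : (S.plus × S.plus) ≃ₗ[ℝ] 𝔤 :=
  LinearEquiv.ofBijective (S.plus.subtype.coprod (S.J ∘ₗ S.plus.subtype)) <| by
    constructor
    · rw [injective_iff_map_eq_zero]
      rintro ⟨X, Y⟩ h
      simp only [LinearMap.coprod_apply, Submodule.subtype_apply, LinearMap.comp_apply] at h
      have hA := congrArg S.A h
      rw [map_add, A_J, A_plus, A_plus, map_zero] at hA
      have hX : (X : 𝔤) = 0 := by
        have : (2 : ℝ) • (X : 𝔤) = 0 := by
          refine Eq.trans ?_ ((congrArg₂ (· + ·) h hA).trans (add_zero 0))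
          module
        simpa using this
      have hY : (Y : 𝔤) = 0 := by
        rw [hX, zero_add] at h
        rw [← neg_eq_zero, ← S.J_J, h, map_zero]
      ext <;> assumption
    · intro Z
      refine ⟨⟨⟨(2⁻¹ : ℝ) • (Z + S.A Z), ?_⟩, ⟨-((2⁻¹ : ℝ) • S.J (Z - S.A Z)), ?_⟩⟩, ?_⟩
      · simp [A_A, add_comm]
      · simp [A_A, A_J, smul_sub, neg_add_eq_sub]
      · simp only [LinearMap.coprod_apply, Submodule.subtype_apply, LinearMap.comp_apply, map_neg,
          map_smul, J_J]
        module

theorem splitting_apply (X Y : S.plus) : S.splitting (X, Y) = X + S.J Y := rfl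

/-- The bracket of an element of the `+1`-eigenspace with the image under `J` of another one. -/
noncomputable def mixed : S.plus →ₗ[ℝ] S.plus →ₗ[ℝ] 𝔤 :=
  (LieModule.toEnd ℝ 𝔤 𝔤 : 𝔤 →ₗ[ℝ] Module.End ℝ 𝔤).compl₁₂ S.plus.subtype
    (S.J ∘ₗ S.plus.subtype)

theorem mixed_apply (X Y : S.plus) : S.mixed X Y = ⁅(X : 𝔤), S.J Y⁆ := rfl

/-- The component of `[X, J Y]` in the `+1`-eigenspace. -/
noncomputable def mixedPlus : S.plus →ₗ[ℝ] S.plus →ₗ[ℝ] S.plus :=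
  S.mixed.compr₂ (LinearMap.fst ℝ S.plus S.plus ∘ₗ S.splitting.symm.toLinearMap)

/-- The element whose image under `J` is the component of `[X, J Y]` in the `-1`-eigenspace. -/
noncomputable def mixedMinus : S.plus →ₗ[ℝ] S.plus →ₗ[ℝ] S.plus :=
  S.mixed.compr₂ (LinearMap.snd ℝ S.plus S.plus ∘ₗ S.splitting.symm.toLinearMap)

theorem splitting_symm_mixed (X Y : S.plus) :
    S.splitting.symm (S.mixed X Y) = (S.mixedPlus X Y, S.mixedMinus X Y) := rfl

theorem mixed_eq (X Y : S.plus) :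
    S.mixed X Y = S.mixedPlus X Y + S.J (S.mixedMinus X Y) := by
  rw [← splitting_apply, ← splitting_symm_mixed, LinearEquiv.apply_symm_apply]

theorem mixed_congr {X Y X' Y' : S.plus} (h : S.mixed X Y = S.mixed X' Y') :
    S.mixedPlus X Y = S.mixedPlus X' Y' ∧ S.mixedMinus X Y = S.mixedMinus X' Y' := by
  rw [← Prod.mk_inj, ← splitting_symm_mixed, h, splitting_symm_mixed]

/-- The form `ω (J X, Y)` on the `+1`-eigenspace. -/
noncomputable def plusForm : LinearMap.BilinForm ℝ S.plus :=
  S.ω.compl₁₂ (S.J ∘ₗ S.plus.subtype) S.plus.subtype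

theorem plusForm_apply (X Y : S.plus) : S.plusForm X Y = S.ω (S.J X) Y := rfl

theorem plusForm_symm (X Y : S.plus) : S.plusForm X Y = S.plusForm Y X := S.ω_J_symm X Y

theorem plusForm_separating (X : S.plus) (h : ∀ Y, S.plusForm X Y = 0) : X = 0 := by
  have hJ : S.J X = 0 := S.ω_nondegenerate.1 _ fun Z => by
    obtain ⟨⟨Y, Y'⟩, rfl⟩ := S.splitting.surjective Z
    rw [splitting_apply, map_add, ω_J_J, add_zero]
    exact h Y
  ext
  rw [ZeroMemClass.coe_zero, ← neg_eq_zero, ← S.J_J, hJ, map_zero]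

theorem ω_mixed_plus (X Y Z : S.plus) :
    S.ω (S.mixed X Y) Z = S.plusForm (S.mixedMinus X Y) Z := by
  rw [mixed_eq, map_add, LinearMap.add_apply, ω_plus_plus, zero_add, plusForm_apply]

theorem ω_mixed_minus (X Y Z : S.plus) :
    S.ω (S.mixed X Y) (S.J Z) = -S.plusForm Z (S.mixedPlus X Y) := by
  rw [mixed_eq, map_add, LinearMap.add_apply, ω_J_J, add_zero, plusForm_apply, ω_swap]

section Abelian

variable {S} (hS : S.IsIntegrable) (hp : IsLieAbelian hS.gPlus) (hm : IsLieAbelian hS.gMinus)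

include hp in
theorem lie_plus_plus (X Y : S.plus) : ⁅(X : 𝔤), (Y : 𝔤)⁆ = 0 :=
  congrArg Subtype.val (hp.trivial (⟨X, X.2⟩ : hS.gPlus) (⟨Y, Y.2⟩ : hS.gPlus))

include hm in
theorem lie_J_J (X Y : S.plus) : ⁅S.J X, S.J Y⁆ = 0 :=
  congrArg Subtype.val (hm.trivial (⟨_, S.J_mem_minus X⟩ : hS.gMinus)
    (⟨_, S.J_mem_minus Y⟩ : hS.gMinus))

theorem lie_J_left (X Y : S.plus) : ⁅S.J X, (Y : 𝔤)⁆ = -S.mixed Y X := by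
  rw [← lie_skew, mixed_apply]

include hp hm

/-- With both eigenspaces abelian, the Nijenhuis tensor at X, Y reduces to J([Y, JX] - [X, JY]). -/
theorem mixed_comm (X Y : S.plus) : S.mixed X Y = S.mixed Y X := by
  have h := hS.nijenhuis_eq_zero X Y
  rw [nijenhuis, lie_J_J hS hm, lie_plus_plus hS hp, lie_J_left, ← mixed_apply, zero_sub, sub_zero,
    map_neg, neg_neg, ← map_sub] at h
  have := congrArg S.J h
  rw [J_J, map_zero, neg_eq_zero, sub_eq_zero] at this
  exact this.symm

-- This is the Jacobi identity for X, Y, JZ: only the component of [Y, JZ] in 𝔤₋ has a bracket with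
-- X.
omit hm in
theorem mixed_mixedMinus (X Y Z : S.plus) :
    S.mixed X (S.mixedMinus Y Z) = S.mixed Y (S.mixedMinus X Z) := by
  have key (X Y Z : S.plus) : ⁅(X : 𝔤), S.mixed Y Z⁆ = S.mixed X (S.mixedMinus Y Z) := by
    rw [mixed_eq, lie_add, lie_plus_plus hS hp, zero_add, mixed_apply]
  have h := leibniz_lie (X : 𝔤) (Y : 𝔤) (S.J Z)
  rwa [lie_plus_plus hS hp, zero_lie, zero_add, ← mixed_apply, ← mixed_apply, key, key] at h

/-- This is the Jacobi identity for JX, JY, Z. -/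
theorem mixed_mixedPlus (X Y Z : S.plus) :
    S.mixed X (S.mixedPlus Y Z) = S.mixed Y (S.mixedPlus X Z) := by
  have hc (X Y : S.plus) : S.mixedPlus X Y = S.mixedPlus Y X :=
    (S.mixed_congr (mixed_comm hS hp hm X Y)).1
  have key (X Y Z : S.plus) : ⁅S.J X, S.mixed Z Y⁆ = -S.mixed X (S.mixedPlus Y Z) := by
    rw [mixed_eq, lie_add, lie_J_J hS hm, add_zero, lie_J_left, mixed_comm hS hp hm, hc]
  have h := leibniz_lie (S.J X) (S.J Y) (Z : 𝔤)
  rw [lie_J_J hS hm, zero_lie, zero_add, lie_J_left, lie_J_left, lie_neg, lie_neg, key, key] at h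
  simpa using h

/-- This is dω(Y, Z, JX) = 0; evaluating at JY, JZ, X instead gives the invariance of p. -/
theorem plusForm_mixedMinus (X Y Z : S.plus) :
    S.plusForm (S.mixedMinus X Y) Z = S.plusForm Y (S.mixedMinus X Z) := by
  have hc (X Y : S.plus) : S.mixedMinus X Y = S.mixedMinus Y X :=
    (S.mixed_congr (mixed_comm hS hp hm X Y)).2
  have h := hS.closed Y Z (S.J X)
  rw [ceDifferential, lie_plus_plus hS hp, ← mixed_apply, ← mixed_apply, ω_mixed_plus,
    ω_mixed_plus, hc Y, hc Z, plusForm_symm _ _ Y] at h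
  simp at h
  linarith

omit hp in
theorem plusForm_mixedPlus (X Y Z : S.plus) :
    S.plusForm (S.mixedPlus X Y) Z = S.plusForm Y (S.mixedPlus X Z) := by
  have h := hS.closed (S.J Y) (S.J Z) X
  rw [ceDifferential, lie_J_J hS hm, lie_J_left, lie_J_left, map_neg, map_neg, LinearMap.neg_apply,
    LinearMap.neg_apply, ω_mixed_minus, ω_mixed_minus] at h
  simp at h
  rw [plusForm_symm]
  linarith

omit hp hm in
theorem finrank_plus (hdim : Module.finrank ℝ 𝔤 = 6) : Module.finrank ℝ S.plus = 3 := by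
  have : FiniteDimensional ℝ 𝔤 := .of_finrank_pos (by rw [hdim]; norm_num)
  have h := S.splitting.finrank_eq
  rw [Module.finrank_prod, hdim] at h
  omega

/-- The Frobenius pair of an integrable Born structure with abelian eigenspaces. -/
noncomputable def frobeniusPair (hdim : Module.finrank ℝ 𝔤 = 6) (hnil : LieRing.IsNilpotent 𝔤) :
    FrobeniusPair S.plus where
  finrank_eq := finrank_plus hdim
  b := S.plusForm
  p := S.mixedPlus
  q := S.mixedMinus
  b_symm := S.plusForm_symm
  b_separating := S.plusForm_separating
  p_comm X Y := (S.mixed_congr (mixed_comm hS hp hm X Y)).1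
  q_comm X Y := (S.mixed_congr (mixed_comm hS hp hm X Y)).2
  p_inv := plusForm_mixedPlus hS hm
  q_inv := plusForm_mixedMinus hS hp hm
  pp X Y Z := (S.mixed_congr (mixed_mixedPlus hS hp hm X Y Z)).1
  pq X Y Z := (S.mixed_congr (mixed_mixedMinus hS hp X Y Z)).1
  qp X Y Z := (S.mixed_congr (mixed_mixedPlus hS hp hm X Y Z)).2
  qq X Y Z := (S.mixed_congr (mixed_mixedMinus hS hp X Y Z)).2
  p_nil X := by
    -- The operator ad(-JX) kills 𝔤₋ and induces p(X,·) on the quotient 𝔤/𝔤₋ ≅ V.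
    refine apply_three_eq_zero_of_isNilpotent (finrank_plus hdim)
      (LieModule.isNilpotent_toEnd_of_isNilpotent ℝ 𝔤 𝔤 (-S.J X))
      (φ := LinearMap.fst ℝ S.plus S.plus ∘ₗ S.splitting.symm.toLinearMap)
      (Prod.fst_surjective.comp S.splitting.symm.surjective) fun W => ?_
    obtain ⟨⟨Y, Z⟩, rfl⟩ := S.splitting.surjective W
    rw [LieModule.toEnd_apply_apply, splitting_apply, neg_lie, lie_add, lie_J_J hS hm, lie_J_left,
      add_zero, neg_neg, mixed_comm hS hp hm, ← splitting_apply]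
    simp [splitting_symm_mixed]
  q_nil X := by
    -- Dually, ad X kills 𝔤₊ and induces q(X,·) on 𝔤/𝔤₊ ≅ V.
    refine apply_three_eq_zero_of_isNilpotent (finrank_plus hdim)
      (LieModule.isNilpotent_toEnd_of_isNilpotent ℝ 𝔤 𝔤 (X : 𝔤))
      (φ := LinearMap.snd ℝ S.plus S.plus ∘ₗ S.splitting.symm.toLinearMap)
      (Prod.snd_surjective.comp S.splitting.symm.surjective) fun W => ?_
    obtain ⟨⟨Y, Z⟩, rfl⟩ := S.splitting.surjective W
    rw [LieModule.toEnd_apply_apply, splitting_apply, lie_add, lie_plus_plus hS hp, zero_add,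
      ← mixed_apply, ← splitting_apply]
    simp [splitting_symm_mixed]

theorem isDouble_frobeniusPair (hdim : Module.finrank ℝ 𝔤 = 6) (hnil : LieRing.IsNilpotent 𝔤) :
    (frobeniusPair hS hp hm hdim hnil).IsDouble S.splitting where
  fst_fst X Y := by simpa [splitting_apply] using lie_plus_plus hS hp X Y
  snd_snd X Y := by simpa [splitting_apply] using lie_J_J hS hm X Y
  fst_snd X Y := by simpa [splitting_apply, mixed_apply] using! S.mixed_eq X Y

end Abelian

end BornStructure

end BornLie

theorem mainTheorem10 {𝔤 : Type*} [LieRing 𝔤] [LieAlgebra ℝ 𝔤]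
    (hdim : Module.finrank ℝ 𝔤 = 6) (hnil : LieRing.IsNilpotent 𝔤) (hna : ¬ IsLieAbelian 𝔤) :
    (∃ (S : BornLie.BornStructure 𝔤) (hS : S.IsIntegrable),
        IsLieAbelian hS.gPlus ∧ IsLieAbelian hS.gMinus) ↔
      (Nonempty (𝔤 ≃ₗ⁅ℝ⁆ BornLie.H8) ∨ Nonempty (𝔤 ≃ₗ⁅ℝ⁆ BornLie.H9)) := by
  constructor
  · rintro ⟨S, hS, hp, hm⟩
    exact (BornLie.BornStructure.isDouble_frobeniusPair hS hp hm hdim hnil).nonempty_equiv hna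
  · rintro (⟨⟨e⟩⟩ | ⟨⟨e⟩⟩)
    · exact BornLie.exists_integrable_of_equiv_H8 e
    · exact BornLie.exists_integrable_of_equiv_H9 e
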